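/- Let $U=(U_t)_{t\in[0,1]}$ be a copula process in $C[0,1]$, that is, a stochastic process with continuous sample paths each of whose components $U_t$ is uniformly distributed on $(0,1)$. Let $Z=(Z_t)_{t\in[0,1]}$ be a generator process, that is, a process with continuous sample paths such that almost surely $0\le Z_t\le q$ for all $t\in[0,1]$, with some constant $q$, and such that $E(Z_t)=1$ for all $t\in[0,1]$. Let $E^-[0,1]$ be the set of bounded functions $f:[0,1]\to(-\infty,0]$ with only finitely many discontinuities, and put $\|f\|_D=E\bigl(\sup_{t\in[0,1]}|f(t)|Z_t\bigr)$. Suppose that for some $\delta>0$, as $c\downarrow 0$, $$P\bigl(U_t\le 1+cf(t)\text{ for all }t\in[0,1]\bigr)=1-c\,\|f\|_D+O\bigl(c^{1+\delta}\bigr)$$ uniformly for all $f\in E^-[0,1]$ with $\|f\|_\infty\le 1$. For each $n$ let $0=t^{(d_n)}_1<t^{(d_n)}_2<\dots<t^{(d_n)}_{d_n}=1$ be a grid of $d_n$ points, where $d_n\to\infty$ and $\max_{1\le i\le d_n-1}|t^{(d_n)}_{i+1}-t^{(d_n)}_i|\to0$ as $n\to\infty$. For each $n$ let $U^{(1)},\dots,U^{(n)}$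 be independent copies of $U$. Fix an integer $k\ge1$, and for $c\in\mathbb R$ and $1\le j\le k$ let $$n_j(c)=\#\Bigl\{1\le i\le n:\ U^{(i)}_{t^{(d_n)}_r}>1-\tfrac cj\text{ for at least one }r\in\{1,\dots,d_n\}\Bigr\},$$ $$T_n(c)=\frac{\sum_{j=1}^k\bigl(j\,n_j(c)-\frac1k\sum_{\ell=1}^k\ell\,n_\ell(c)\bigr)^2}{\frac1k\sum_{\ell=1}^k\ell\,n_\ell(c)},$$ with $T_n(c)=0$ if the denominator is $0$. Let $(c_n)$ be a real sequence with $c_n\to0$, $nc_n\to\infty$ and $nc_n^{1+2\delta}\to0$ as $n\to\infty$ (so $0<c_n<1$ for all large $n$). Then, as $n\to\infty$, $T_n(c_n)$ converges in distribution to $$\sum_{i=1}^{k-1}\lambda_i\xi_i^2,\qquad \lambda_i=\frac1{4\sin^2\bigl(\frac ik\frac\pi2\bigr)},$$ where $\xi_1,\dots,\xi_{k-1}$ are independent standard normal random variables. -/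

import Mathlib

open Filter Topology MeasureTheory ProbabilityTheory
open scoped unitInterval NNReal

noncomputable section

/-- A stochastic process with index set `[0,1]` and sample paths in `C[0,1]`. -/
structure IsContinuousProcess {Ω : Type*} [MeasurableSpace Ω] (X : I → Ω → ℝ) : Prop where
  measurable : ∀ t, Measurable (X t)
  continuous : ∀ ω, Continuous fun t => X t ω

/-- A copula process in `C[0,1]`: each `U t` is uniformly distributed on `(0,1)`. -/
structure IsCopulaProcess {Ω : Type*} [MeasurableSpace Ω] (U : I → Ω → ℝ) (P : Measure Ω) :
    Prop extends IsContinuousProcess U where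
  uniform : ∀ t, pdf.IsUniform (U t) (Set.Ioo 0 1) P

/-- A generator process: continuous sample paths, `0 ≤ Z t ≤ q` for a constant `q`, and
`E (Z t) = 1`. -/
structure IsGeneratorProcess {Ω : Type*} [MeasurableSpace Ω] (Z : I → Ω → ℝ) (P : Measure Ω) :
    Prop extends IsContinuousProcess Z where
  bounded : ∃ q : ℝ, ∀ᵐ ω ∂P, ∀ t, 0 ≤ Z t ω ∧ Z t ω ≤ q
  mean_one : ∀ t, ∫ ω, Z t ω ∂P = 1

/-- `E⁻[0,1]`: the bounded nonpositive functions on `[0,1]` with finitely many discontinuities. -/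
def EMinus : Set (I → ℝ) :=
  {f | (∃ B : ℝ, ∀ t, |f t| ≤ B) ∧ {t | ¬ ContinuousAt f t}.Finite ∧ ∀ t, f t ≤ 0}

/-- The `D`-norm generated by `Z`: `‖f‖_D = E (sup_t |f t| * Z t)`. -/
def dNorm {Ω : Type*} [MeasurableSpace Ω] (Z : I → Ω → ℝ) (P : Measure Ω) (f : I → ℝ) : ℝ :=
  ∫ ω, ⨆ t, |f t| * Z t ω ∂P

/-- `P (U ≤ 1 + c f) = 1 - c ‖f‖_D + O (c ^ (1 + δ))` as `c ↓ 0`, uniformly for all `f ∈ E⁻[0,1]`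
with `‖f‖_∞ ≤ 1`, where `‖·‖_D` is the `D`-norm generated by `Z`. -/
def UniformDeltaNeighborhood {Ω Ω' : Type*} [MeasurableSpace Ω] [MeasurableSpace Ω']
    (U : I → Ω → ℝ) (P : Measure Ω) (Z : I → Ω' → ℝ) (Q : Measure Ω') (δ : ℝ) : Prop :=
  ∃ K : ℝ, ∀ᶠ c in 𝓝[>] (0 : ℝ), ∀ f ∈ EMinus, (∀ t, |f t| ≤ 1) →
    |P.real {ω | ∀ t, U t ω ≤ 1 + c * f t} - (1 - c * dNorm Z Q f)| ≤ K * c ^ (1 + δ)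

/-- `0 = t 1 < t 2 < ⋯ < t d = 1` (only the values of `t` at `1, …, d` matter). -/
def IsGrid (d : ℕ) (t : ℕ → I) : Prop :=
  2 ≤ d ∧ t 1 = 0 ∧ t d = 1 ∧ StrictMonoOn t (Set.Icc 1 d)

/-- The mesh `max_{1 ≤ i ≤ d - 1} |t (i+1) - t i|` of a grid. -/
def gridMesh (d : ℕ) (t : ℕ → I) : ℝ≥0 :=
  (Finset.Icc 1 (d - 1)).sup fun i => nndist (t (i + 1)) (t i)

/-- `S_u(s) = ∑_{r=1}^d 1_{(s,∞)} (u r - 1)` for a vector `u = (u 1, …, u d)`. -/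
def discreteSojourn (d : ℕ) (u : ℕ → ℝ) (s : ℝ) : ℝ :=
  ∑ r ∈ Finset.Icc 1 d, (Set.Ioi s).indicator (fun _ => (1 : ℝ)) (u r - 1)

/-- `n_j(c)`: the number of vectors among `u 0, …, u (n-1)` with positive sojourn time above
`1 - c / j`. -/
def exceedanceCount {n : ℕ} (d : ℕ) (u : Fin n → ℕ → ℝ) (c : ℝ) (j : ℕ) : ℝ :=
  ∑ i, (Set.Ioi (0 : ℝ)).indicator (fun _ => (1 : ℝ)) (discreteSojourn d (u i) (-(c / j)))

/-- `k⁻¹ ∑_{ℓ=1}^k ℓ n_ℓ(c)`. -/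
def meanCount {n : ℕ} (k d : ℕ) (u : Fin n → ℕ → ℝ) (c : ℝ) : ℝ :=
  1 / (k : ℝ) * ∑ l ∈ Finset.Icc 1 k, (l : ℝ) * exceedanceCount d u c l

/-- The test statistic `T_n(c)` based on the `d`-dimensional vectors `u 0, …, u (n-1)`. -/
def testStatistic {n : ℕ} (k d : ℕ) (u : Fin n → ℕ → ℝ) (c : ℝ) : ℝ :=
  (∑ j ∈ Finset.Icc 1 k, ((j : ℝ) * exceedanceCount d u c j - meanCount k d u c) ^ 2) /
    meanCount k d u c

/-- `λ_i = 1 / (4 sin² ((i / k) (π / 2)))`. -/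
def limitWeight (k i : ℕ) : ℝ :=
  1 / (4 * Real.sin ((i : ℝ) / k * (Real.pi / 2)) ^ 2)

end

/-! Indices are shifted: `j < k` stands for the level `1 - c / (j + 1)`. Let `p_j` be the
probability that a path exceeds this level somewhere on the grid. Applying the neighbourhood
condition to the function that is `-1` on the grid and `0` elsewhere gives `(j + 1) p_j = c m + O(c
^ (1 + δ))`, where `m` is the D-norm of that function and does not depend on `j`. Hence all weighted
counts have nearly the common mean `a = n c m`, and since `n c ^ (1 + 2δ) → 0` the discrepancy is
`o(√a)`.

The exceedance events are nested, so the product of two weighted indicators has expectation `(j + 1)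
(l + 1) p_(max j l) ≈ min (j + 1) (l + 1) c m`. A contrast `∑ β_j (j + 1) n_(j+1)` with `∑ β_j = 0`,
divided by `√a`, is therefore asymptotically centred normal, with variance the quadratic form of the
matrix `min (j + 1) (l + 1)` at `β` (`tendsto_charFun_contrast`).

The dispersion about the mean is the sum of squares of the nonconstant discrete cosine coefficients.
These contrasts also diagonalise the `min` form, with eigenvalues `1 / (4 sin²)`: summation by parts
turns cosines into sines, which are again orthogonal (`sum_diagCoeff_mul_min`,
`sum_sub_mean_sq_eq_sum_limitWeight`). The numerator over `a` thus tends to the weighted chi-square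
sum, the denominator over `a` tends to `1` in probability (`tendsto_measureReal_mean`), and
Slutsky's theorem concludes. -/

/-! ### Trigonometric sums -/

lemma sin_half_mul_sum_cos (x : ℝ) (k : ℕ) :
    2 * Real.sin (x / 2) * ∑ j ∈ Finset.range k, Real.cos (x * (j + 1 / 2)) = Real.sin (x * k) := by
  induction k with
  | zero => simp
  | succ k ih =>
    rw [Finset.sum_range_succ, mul_add, ih]
    have h1 : x * ((k + 1 : ℕ) : ℝ) = x * (k + 1 / 2) + x / 2 := by push_cast; ring
    have h2 : x * (k : ℝ) = x * (k + 1 / 2) - x / 2 := by ring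
    rw [h1, h2, Real.sin_add, Real.sin_sub]
    ring

lemma sin_half_mul_sum_cos_nat (x : ℝ) (k : ℕ) :
    2 * Real.sin (x / 2) * ∑ j ∈ Finset.range k, Real.cos (x * j) =
      Real.sin (x * k - x / 2) + Real.sin (x / 2) := by
  induction k with
  | zero => simp
  | succ k ih =>
    rw [Finset.sum_range_succ, mul_add, ih]
    have h1 : x * ((k + 1 : ℕ) : ℝ) - x / 2 = x * k + x / 2 := by push_cast; ring
    rw [h1, Real.sin_add, Real.sin_sub]
    ring

lemma sin_int_mul_pi_div_ne_zero {k : ℕ} {m : ℤ} (hm : m ≠ 0) (hk : |m| < 2 * k) :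
    Real.sin (m * Real.pi / k / 2) ≠ 0 := by
  have hk0 : (0 : ℝ) < k := by
    have := abs_nonneg m
    have : 0 < (k : ℤ) := by omega
    exact_mod_cast this
  rw [Ne, Real.sin_eq_zero_iff]
  rintro ⟨l, hl⟩
  have hpi := Real.pi_ne_zero
  field_simp at hl
  have h2 : 2 * k * l = m := by
    have : (2 * k * l : ℝ) = m := by linarith
    exact_mod_cast this
  rcases eq_or_ne l 0 with rfl | h
  · simp at h2; exact hm h2.symm
  · have : 1 ≤ |l| := Int.one_le_abs h
    rw [← h2, abs_mul, abs_mul] at hk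
    simp at hk
    nlinarith [abs_nonneg (k : ℤ)]

lemma sum_cos_midpoint_eq_zero {k : ℕ} {m : ℤ} (hm : m ≠ 0) (hk : |m| < 2 * k) :
    ∑ j ∈ Finset.range k, Real.cos (m * Real.pi / k * (j + 1 / 2)) = 0 := by
  have h := sin_half_mul_sum_cos (m * Real.pi / k) k
  have hk0 : (k : ℝ) ≠ 0 := by
    rintro h0
    have : k = 0 := by exact_mod_cast h0
    subst this
    have := abs_nonneg m
    simp at hk; omega
  rw [div_mul_cancel₀ _ hk0, Real.sin_int_mul_pi] at h
  have := sin_int_mul_pi_div_ne_zero hm hk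
  simpa [this] using h

/-- The value depends only on the parity of `m`, so sums at two admissible frequencies of equal
parity cancel in `sum_diagCoeff_mul_min`. -/
lemma sum_cos_nat_eq {k : ℕ} {m : ℤ} (hm : m ≠ 0) (hk : |m| < 2 * k) :
    ∑ j ∈ Finset.range k, Real.cos (m * Real.pi / k * j) = (1 - (-1) ^ m) / 2 := by
  have h := sin_half_mul_sum_cos_nat (m * Real.pi / k) k
  have hk0 : (k : ℝ) ≠ 0 := by
    rintro h0
    have : k = 0 := by exact_mod_cast h0
    subst this
    have := abs_nonneg m
    simp at hk; omega
  have hs := sin_int_mul_pi_div_ne_zero hm hk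
  rw [div_mul_cancel₀ _ hk0, Real.sin_sub, Real.sin_int_mul_pi, Real.cos_int_mul_pi] at h
  have h' : 2 * Real.sin (m * Real.pi / k / 2) *
      (∑ j ∈ Finset.range k, Real.cos (m * Real.pi / k * j) - (1 - (-1) ^ m) / 2) = 0 := by
    rw [mul_sub, h]; ring
  simpa [hs, sub_eq_zero] using h'

/-! ### Discrete cosine basis and the dispersion about the mean -/

/-- Orthonormal discrete cosine vectors on `{0, …, k - 1}`. -/
noncomputable def dctVec (k i j : ℕ) : ℝ :=
  (if i = 0 then √(1 / k) else √(2 / k)) * Real.cos (i * Real.pi / k * (j + 1 / 2))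

lemma sum_dctVec_mul {k i i' : ℕ} (hi : i < k) (hi' : i' < k) :
    ∑ j ∈ Finset.range k, dctVec k i j * dctVec k i' j = if i = i' then 1 else 0 := by
  have hk : (0 : ℝ) < k := by exact_mod_cast (by omega : 0 < k)
  have hcos : ∀ j : ℕ, Real.cos (i * Real.pi / k * (j + 1 / 2)) *
      Real.cos (i' * Real.pi / k * (j + 1 / 2)) =
      (Real.cos (((i - i' : ℤ) : ℝ) * Real.pi / k * (j + 1 / 2)) +
        Real.cos (((i + i' : ℤ) : ℝ) * Real.pi / k * (j + 1 / 2))) / 2 := by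
    intro j
    have e1 : ((i - i' : ℤ) : ℝ) * Real.pi / k * (j + 1 / 2) =
      i * Real.pi / k * (j + 1 / 2) - i' * Real.pi / k * (j + 1 / 2) := by push_cast; ring
    have e2 : ((i + i' : ℤ) : ℝ) * Real.pi / k * (j + 1 / 2) =
      i * Real.pi / k * (j + 1 / 2) + i' * Real.pi / k * (j + 1 / 2) := by push_cast; ring
    rw [e1, e2, Real.cos_sub, Real.cos_add]
    ring
  have key : ∑ j ∈ Finset.range k, dctVec k i j * dctVec k i' j =
      (if i = 0 then √(1 / k) else √(2 / k)) * (if i' = 0 then √(1 / k) else √(2 / k)) *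
      ((∑ j ∈ Finset.range k, Real.cos (((i - i' : ℤ) : ℝ) * Real.pi / k * (j + 1 / 2)) +
        ∑ j ∈ Finset.range k, Real.cos (((i + i' : ℤ) : ℝ) * Real.pi / k * (j + 1 / 2))) / 2) := by
    rw [← Finset.sum_add_distrib, Finset.sum_div, Finset.mul_sum]
    refine Finset.sum_congr rfl fun j _ => ?_
    rw [← hcos, dctVec, dctVec]; ring
  rw [key]
  by_cases h : i = i'
  · subst h
    by_cases h0 : i = 0
    · subst h0
      simp only [if_true]
      rw [Real.mul_self_sqrt (by positivity)]
      simp [hk.ne']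
    · rw [sum_cos_midpoint_eq_zero (m := i + i) (by omega) (by rw [abs_lt]; omega)]
      simp only [h0, if_false, if_true]
      rw [Real.mul_self_sqrt (by positivity)]
      simp [hk.ne']
  · rw [sum_cos_midpoint_eq_zero (m := i + i') (by omega) (by rw [abs_lt]; omega),
      sum_cos_midpoint_eq_zero (m := i - i') (by omega) (by rw [abs_lt]; omega)]
    simp [h]

/-- Parseval's identity: for a square matrix, orthonormal rows force orthonormal columns. -/
lemma sum_sq_eq_sum_dctVec_sq (k : ℕ) (x : ℕ → ℝ) :
    ∑ j ∈ Finset.range k, x j ^ 2 =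
      ∑ i ∈ Finset.range k, (∑ j ∈ Finset.range k, dctVec k i j * x j) ^ 2 := by
  let C : Matrix (Fin k) (Fin k) ℝ := Matrix.of fun i j => dctVec k i j
  have h1 : C * C.transpose = 1 := by
    ext i i'
    rw [Matrix.mul_apply, Matrix.one_apply]
    simp only [C, Matrix.transpose_apply, Matrix.of_apply]
    rw [Fin.sum_univ_eq_sum_range (fun j => dctVec k i j * dctVec k i' j) k,
      sum_dctVec_mul i.2 i'.2]
    simp [Fin.ext_iff]
  have h2 : C.transpose * C = 1 := mul_eq_one_comm.mp h1
  let y : Fin k → ℝ := fun j => x j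
  have h3 : (C.mulVec y) ⬝ᵥ (C.mulVec y) = y ⬝ᵥ y := by
    rw [Matrix.dotProduct_mulVec, Matrix.vecMul_mulVec, h2]
    simp
  have h4 : ∀ i : Fin k, C.mulVec y i = ∑ j ∈ Finset.range k, dctVec k i j * x j := by
    intro i
    rw [← Fin.sum_univ_eq_sum_range (fun j => dctVec k i j * x j) k]
    rfl
  simp only [dotProduct, h4, y] at h3
  rw [← Fin.sum_univ_eq_sum_range (fun j => x j ^ 2) k, ← Fin.sum_univ_eq_sum_range
    (fun i => (∑ j ∈ Finset.range k, dctVec k i j * x j) ^ 2) k]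
  simp only [sq]
  exact h3.symm

lemma sum_dctVec_eq_zero {k i : ℕ} (hi : i < k) (hi0 : i ≠ 0) :
    ∑ j ∈ Finset.range k, dctVec k i j = 0 := by
  simp only [dctVec]
  rw [← Finset.mul_sum]
  have := sum_cos_midpoint_eq_zero (k := k) (m := i) (by omega) (by rw [abs_lt]; omega)
  simp only [Int.cast_natCast] at this
  rw [this, mul_zero]

/-- Row `0` of the cosine basis is constant and the other rows sum to zero, so subtracting the mean
removes exactly the coefficient of index `0`. -/
lemma sum_sub_mean_sq_eq {k : ℕ} (hk : 1 ≤ k) (x : ℕ → ℝ) :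
    ∑ j ∈ Finset.range k, (x j - 1 / k * ∑ l ∈ Finset.range k, x l) ^ 2 =
      ∑ i ∈ Finset.range (k - 1), (∑ j ∈ Finset.range k, dctVec k (i + 1) j * x j) ^ 2 := by
  have hk0 : (k : ℝ) ≠ 0 := by positivity
  obtain ⟨m, rfl⟩ : ∃ m, k = m + 1 := ⟨k - 1, by omega⟩
  rw [sum_sq_eq_sum_dctVec_sq, Finset.sum_range_succ' _ m]
  simp only [add_tsub_cancel_right]
  have h0 : ∑ j ∈ Finset.range (m + 1), dctVec (m + 1) 0 j *
      (x j - 1 / ((m + 1 : ℕ) : ℝ) * ∑ l ∈ Finset.range (m + 1), x l) = 0 := by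
    simp only [dctVec, if_true, Nat.cast_zero, zero_mul, zero_div, Real.cos_zero, mul_one]
    rw [← Finset.mul_sum, Finset.sum_sub_distrib]
    simp only [Finset.sum_const, Finset.card_range, nsmul_eq_mul]
    field_simp
    simp
  rw [h0]
  simp only [ne_eq, OfNat.ofNat_ne_zero, not_false_eq_true, zero_pow, add_zero]
  refine Finset.sum_congr rfl fun i hi => ?_
  congr 1
  simp only [mul_sub]
  rw [Finset.sum_sub_distrib, ← Finset.sum_mul, sum_dctVec_eq_zero (by simpa using hi) (by omega)]
  simp

/-! ### Diagonalisation of the `min` covariance -/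

/-- Coefficients of the linear functionals that diagonalise the covariance `min (j + 1) (l + 1)`. -/
noncomputable def diagCoeff (k i j : ℕ) : ℝ :=
  2 * Real.sin ((i + 1 : ℕ) * Real.pi / k / 2) * dctVec k (i + 1) j

lemma sum_diagCoeff_eq_zero {k i : ℕ} (hi : i < k - 1) :
    ∑ j ∈ Finset.range k, diagCoeff k i j = 0 := by
  simp only [diagCoeff]
  rw [← Finset.mul_sum, sum_dctVec_eq_zero (by omega) (by omega), mul_zero]

lemma sin_diagCoeff_ne_zero {k i : ℕ} (hi : i < k - 1) :
    Real.sin ((i + 1 : ℕ) * Real.pi / k / 2) ≠ 0 := by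
  have := sin_int_mul_pi_div_ne_zero (k := k) (m := (i + 1 : ℕ)) (by omega)
    (by rw [abs_lt]; omega)
  exact_mod_cast this

/-- `diagCoeff` is the cosine vector times `2 sin`; undoing this nonzero factor inside the square
produces `limitWeight`. -/
lemma sum_sub_mean_sq_eq_sum_limitWeight {k : ℕ} (hk : 1 ≤ k) (x : ℕ → ℝ) :
    ∑ j ∈ Finset.range k, (x j - 1 / k * ∑ l ∈ Finset.range k, x l) ^ 2 =
      ∑ i : Fin (k - 1), limitWeight k (i + 1) *
        (∑ j ∈ Finset.range k, diagCoeff k i j * x j) ^ 2 := by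
  rw [sum_sub_mean_sq_eq hk, Fin.sum_univ_eq_sum_range (fun i => limitWeight k (i + 1) *
        (∑ j ∈ Finset.range k, diagCoeff k i j * x j) ^ 2) (k - 1)]
  refine Finset.sum_congr rfl fun i hi => ?_
  have hs := sin_diagCoeff_ne_zero (Finset.mem_range.mp hi)
  have he : ((i + 1 : ℕ) : ℝ) / k * (Real.pi / 2) = (i + 1 : ℕ) * Real.pi / k / 2 := by ring
  simp only [diagCoeff, limitWeight, he, mul_assoc]
  rw [← Finset.mul_sum, ← Finset.mul_sum]
  generalize Real.sin (_ * Real.pi / k / 2) = s at *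
  field_simp
  ring

/-- The total sum vanishes, so the tail is minus the head, and the factor `2 sin` in `diagCoeff` is
what makes the head telescope to a sine. -/
lemma sum_diagCoeff_tail {k i m : ℕ} (hi : i < k - 1) (hm : m ≤ k) :
    ∑ j ∈ Finset.range k, (if m ≤ j then diagCoeff k i j else 0) =
      -(√(2 / k) * Real.sin ((i + 1 : ℕ) * Real.pi / k * m)) := by
  have h1 : ∑ j ∈ Finset.range k, (if m ≤ j then diagCoeff k i j else 0) +
      ∑ j ∈ Finset.range m, diagCoeff k i j = 0 := by
    refine Eq.trans ?_ (sum_diagCoeff_eq_zero hi)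
    rw [← Finset.sum_range_add_sum_Ico (diagCoeff k i) hm, add_comm]
    congr 1
    rw [← Finset.sum_filter]
    refine Finset.sum_congr ?_ fun _ _ => rfl
    ext j
    simp; omega
  have h2 : ∑ j ∈ Finset.range m, diagCoeff k i j =
      √(2 / k) * Real.sin ((i + 1 : ℕ) * Real.pi / k * m) := by
    rw [← sin_half_mul_sum_cos, Finset.mul_sum, Finset.mul_sum]
    refine Finset.sum_congr rfl fun j _ => ?_
    simp only [diagCoeff, dctVec, Nat.succ_ne_zero, if_false]
    ring
  linarith

/-- Since `min (j + 1) (l + 1)` counts the `m` with `m ≤ j` and `m ≤ l`, the form is the inner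
product of the two vectors of tail sums. These are discrete sine vectors, whose orthonormality
follows from the product formula and the parity rule of `sum_cos_nat_eq`. -/
lemma sum_diagCoeff_mul_min {k : ℕ} (i i' : Fin (k - 1)) :
    ∑ j ∈ Finset.range k, ∑ l ∈ Finset.range k,
      diagCoeff k i j * diagCoeff k i' l * (min (j + 1) (l + 1) : ℕ) = if i = i' then 1 else 0 := by
  have hi := i.2
  have hi' := i'.2
  have hk : (0 : ℝ) < k := by exact_mod_cast (by omega : 0 < k)
  have hmin : ∀ j ∈ Finset.range k, ∀ l ∈ Finset.range k, ((min (j + 1) (l + 1) : ℕ) : ℝ) =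
      ∑ m ∈ Finset.range k, (if m ≤ j then (1 : ℝ) else 0) * (if m ≤ l then 1 else 0) := by
    intro j hj l hl
    simp only [Finset.mem_range] at hj hl
    simp only [← ite_and, mul_ite, mul_one, mul_zero]
    rw [← Finset.sum_filter, Finset.sum_const, nsmul_eq_mul, mul_one]
    congr 1
    rw [show (Finset.range k).filter (fun m => m ≤ l ∧ m ≤ j) = Finset.range (min (j + 1) (l + 1))
      by ext m; simp; omega]
    simp
  have h1 : ∑ j ∈ Finset.range k, ∑ l ∈ Finset.range k,
      diagCoeff k i j * diagCoeff k i' l * (min (j + 1) (l + 1) : ℕ) =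
      ∑ m ∈ Finset.range k, (∑ j ∈ Finset.range k, (if m ≤ j then diagCoeff k i j else 0)) *
        (∑ l ∈ Finset.range k, (if m ≤ l then diagCoeff k i' l else 0)) := by
    simp_rw [Finset.sum_mul_sum]
    rw [Finset.sum_comm (s := Finset.range k) (t := Finset.range k)
      (f := fun m j => ∑ l ∈ Finset.range k, (if m ≤ j then diagCoeff k i j else 0) *
        (if m ≤ l then diagCoeff k i' l else 0))]
    refine Finset.sum_congr rfl fun j hj => ?_
    rw [Finset.sum_comm (s := Finset.range k) (t := Finset.range k)
      (f := fun m l => (if m ≤ j then diagCoeff k i j else 0) *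
        (if m ≤ l then diagCoeff k i' l else 0))]
    refine Finset.sum_congr rfl fun l hl => ?_
    rw [hmin j hj l hl, Finset.mul_sum]
    refine Finset.sum_congr rfl fun m _ => ?_
    split_ifs <;> simp
  have h2 : ∀ m ∈ Finset.range k, (∑ j ∈ Finset.range k, (if m ≤ j then diagCoeff k i j else 0)) *
        (∑ l ∈ Finset.range k, (if m ≤ l then diagCoeff k i' l else 0)) =
      1 / k * (Real.cos (((i - i' : ℤ) : ℝ) * Real.pi / k * m) -
        Real.cos (((i + i' + 2 : ℤ) : ℝ) * Real.pi / k * m)) := by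
    intro m hm
    have hm' : m ≤ k := (Finset.mem_range.mp hm).le
    rw [sum_diagCoeff_tail hi hm', sum_diagCoeff_tail hi' hm']
    have e1 : ((i - i' : ℤ) : ℝ) * Real.pi / k * m =
      ((i : ℕ) + 1 : ℕ) * Real.pi / k * m - ((i' : ℕ) + 1 : ℕ) * Real.pi / k * m := by
      push_cast; ring
    have e2 : ((i + i' + 2 : ℤ) : ℝ) * Real.pi / k * m =
      ((i : ℕ) + 1 : ℕ) * Real.pi / k * m + ((i' : ℕ) + 1 : ℕ) * Real.pi / k * m := by
      push_cast; ring
    rw [e1, e2, Real.cos_sub, Real.cos_add]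
    have hs : √(2 / (k : ℝ)) * √(2 / k) = 2 / k := Real.mul_self_sqrt (by positivity)
    linear_combination (Real.sin (((i : ℕ) + 1 : ℕ) * Real.pi / k * m) *
      Real.sin (((i' : ℕ) + 1 : ℕ) * Real.pi / k * m)) * hs
  rw [h1, Finset.sum_congr rfl h2, ← Finset.mul_sum, Finset.sum_sub_distrib,
    sum_cos_nat_eq (m := i + i' + 2) (by omega) (by rw [abs_lt]; omega)]
  by_cases h : i = i'
  · subst h
    have : ((-1 : ℝ)) ^ ((i : ℤ) + i + 2) = 1 := Even.neg_one_zpow ⟨i + 1, by ring⟩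
    simp [this, hk.ne']
  · have hne : (i : ℕ) ≠ i' := fun h' => h (Fin.ext h')
    rw [sum_cos_nat_eq (m := i - i') (by omega) (by rw [abs_lt]; omega)]
    have : ((-1 : ℝ)) ^ ((i : ℤ) + i' + 2) = (-1) ^ ((i : ℤ) - i') := by
      rw [show (i : ℤ) + i' + 2 = (i - i') + 2 * (i' + 1) by ring,
        zpow_add₀ (by norm_num), zpow_mul]
      simp
    rw [this]
    simp [h]

/-! ### Limit theorems for triangular arrays -/

lemma norm_cexp_mul_I_sub_le {x : ℝ} (hx : |x| ≤ 1) :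
    ‖Complex.exp (x * Complex.I) - (1 + x * Complex.I - (x ^ 2 : ℝ) / 2)‖ ≤ |x| ^ 3 := by
  have hn : ‖(x * Complex.I : ℂ)‖ = |x| := by simp
  have h := Complex.exp_bound (x := x * Complex.I) (by rw [hn]; exact hx) (n := 3) (by norm_num)
  rw [hn] at h
  have e : ∑ m ∈ Finset.range 3, (x * Complex.I : ℂ) ^ m / m.factorial =
      1 + x * Complex.I - (x ^ 2 : ℝ) / 2 := by
    simp [Finset.sum_range_succ, mul_pow, Nat.factorial]
    ring
  rw [e] at h
  refine h.trans ?_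
  refine mul_le_of_le_one_right (by positivity) ?_
  norm_num [Nat.factorial]

lemma norm_integral_cexp_mul_I_sub_le {Ω : Type*} [MeasurableSpace Ω] {P : Measure Ω}
    [IsProbabilityMeasure P] {X : Ω → ℝ} (hX : AEMeasurable X P) {ε : ℝ} (hε : ε ≤ 1)
    (hb : ∀ ω, |X ω| ≤ ε) :
    ‖∫ ω, Complex.exp (X ω * Complex.I) ∂P -
      (1 + ((∫ ω, X ω ∂P : ℝ) : ℂ) * Complex.I - ((∫ ω, X ω ^ 2 ∂P : ℝ) : ℂ) / 2)‖ ≤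
      ε * ∫ ω, X ω ^ 2 ∂P := by
  have hX1 : Integrable X P := .of_bound hX.aestronglyMeasurable ε (ae_of_all _ hb)
  have hX2 : Integrable (fun ω => X ω ^ 2) P :=
    .of_bound (hX.pow_const 2).aestronglyMeasurable (ε ^ 2) (ae_of_all _ fun ω => by
      rw [Real.norm_eq_abs, abs_pow]
      exact pow_le_pow_left₀ (abs_nonneg _) (hb ω) 2)
  have hE : Integrable (fun ω => Complex.exp (X ω * Complex.I)) P :=
    .of_bound (C := 1) (by fun_prop) (ae_of_all _ fun ω => by
      rw [Complex.norm_exp_ofReal_mul_I])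
  have hX1c : Integrable (fun ω => (X ω : ℂ) * Complex.I) P := hX1.ofReal.mul_const _
  have hX2c : Integrable (fun ω => ((X ω ^ 2 : ℝ) : ℂ) / 2) P := hX2.ofReal.div_const _
  have hXc : Integrable (fun ω => 1 + (X ω : ℂ) * Complex.I) P := (integrable_const _).add hX1c
  have e : 1 + ((∫ ω, X ω ∂P : ℝ) : ℂ) * Complex.I - ((∫ ω, X ω ^ 2 ∂P : ℝ) : ℂ) / 2 =
      ∫ ω, (1 + X ω * Complex.I - ((X ω ^ 2 : ℝ) : ℂ) / 2) ∂P := by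
    rw [integral_sub hXc hX2c, integral_add (integrable_const _) hX1c,
      integral_mul_const, integral_div, integral_complex_ofReal, integral_complex_ofReal]
    simp
  have hT : Integrable (fun ω => 1 + (X ω : ℂ) * Complex.I - ((X ω ^ 2 : ℝ) : ℂ) / 2) P :=
    hXc.sub hX2c
  rw [e, ← integral_sub hE hT, ← integral_const_mul]
  refine norm_integral_le_of_norm_le (hX2.const_mul ε) (ae_of_all _ fun ω => ?_)
  refine (norm_cexp_mul_I_sub_le ((hb ω).trans hε)).trans ?_
  rw [pow_succ', sq_abs]
  exact mul_le_mul_of_nonneg_right (hb ω) (sq_nonneg _)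

section TriangularArray

variable {Ω₀ : Type*} [MeasurableSpace Ω₀] {P₀ : Measure Ω₀} [IsProbabilityMeasure P₀]
  {Ω : ℕ → Type*} [∀ n, MeasurableSpace (Ω n)] {P : ∀ n, Measure (Ω n)}

/-- Lindeberg-type limit theorem for the characteristic functions of row sums of a triangular
array with i.i.d. uniformly small rows. -/
lemma tendsto_charFun_sum_of_bounded_array {X : ∀ n, Fin n → Ω n → ℝ} {X₀ : ℕ → Ω₀ → ℝ}
    (hind : ∀ n, iIndepFun (X n) (P n))
    (hid : ∀ n i, IdentDistrib (X n i) (X₀ n) (P n) P₀) (hX₀ : ∀ n, AEMeasurable (X₀ n) P₀)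
    {ε : ℕ → ℝ} (hε : Tendsto ε atTop (𝓝 0)) (hb : ∀ n ω, |X₀ n ω| ≤ ε n)
    (h1 : Tendsto (fun n : ℕ => (n : ℝ) * ∫ ω, X₀ n ω ∂P₀) atTop (𝓝 0)) {v : ℝ}
    (h2 : Tendsto (fun n : ℕ => (n : ℝ) * ∫ ω, X₀ n ω ^ 2 ∂P₀) atTop (𝓝 v)) :
    Tendsto (fun n => charFun ((P n).map fun ω => ∑ i, X n i ω) 1) atTop
      (𝓝 (Complex.exp (-(v : ℂ) / 2))) := by
  have hφ : ∀ n, charFun ((P n).map fun ω => ∑ i, X n i ω) 1 =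
      (1 + (∫ ω, Complex.exp (X₀ n ω * Complex.I) ∂P₀ - 1)) ^ n := by
    intro n
    rw [(hind n).charFun_map_fun_sum_eq_prod fun i => (hid n i).aemeasurable_fst,
      Finset.prod_apply, add_sub_cancel]
    have : ∀ i, charFun ((P n).map (X n i)) 1 = ∫ ω, Complex.exp (X₀ n ω * Complex.I) ∂P₀ := by
      intro i
      rw [(hid n i).map_eq, charFun_apply_real, integral_map (hX₀ n) (by fun_prop)]
      simp
    simp [this]
  simp_rw [hφ]
  -- It suffices that `n (φ_n - 1) → -v / 2`. The second-order expansion supplies this limit, with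
  -- an error of at most `ε n` times `n E X²`.
  refine Complex.tendsto_one_add_pow_exp_of_tendsto ?_
  have hmain : Tendsto (fun n : ℕ => (((n : ℝ) * ∫ ω, X₀ n ω ∂P₀ : ℝ) : ℂ) * Complex.I -
      (((n : ℝ) * ∫ ω, X₀ n ω ^ 2 ∂P₀ : ℝ) : ℂ) / 2) atTop (𝓝 (-(v : ℂ) / 2)) := by
    have := (((Complex.continuous_ofReal.tendsto 0).comp h1).mul_const Complex.I).sub
      (((Complex.continuous_ofReal.tendsto v).comp h2).div_const 2)
    rw [show -(v : ℂ) / 2 = ((0 : ℝ) : ℂ) * Complex.I - v / 2 by push_cast; ring]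
    exact this
  refine tendsto_of_tendsto_of_dist hmain ?_
  have hεv : Tendsto (fun n : ℕ => ε n * ((n : ℝ) * ∫ ω, X₀ n ω ^ 2 ∂P₀)) atTop (𝓝 0) := by
    simpa using hε.mul h2
  refine squeeze_zero' (Eventually.of_forall fun _ => dist_nonneg) ?_ hεv
  filter_upwards [hε.eventually_le_const one_pos] with n hn
  have h := mul_le_mul_of_nonneg_left (norm_integral_cexp_mul_I_sub_le (hX₀ n) hn (hb n))
    (Nat.cast_nonneg (α := ℝ) n)
  have hn' : (n : ℝ) = ‖(n : ℂ)‖ := by simp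
  rw [dist_comm, dist_eq_norm]
  refine le_trans (le_of_eq ?_) (h.trans (le_of_eq (by ring)))
  conv_rhs => rw [hn', ← norm_mul]
  congr 1
  push_cast
  ring

/-- Weak law of large numbers for triangular arrays with i.i.d. nonnegative uniformly small rows. -/
lemma tendsto_measureReal_sum_sub_one_of_bounded_array [∀ n, IsProbabilityMeasure (P n)]
    {X : ∀ n, Fin n → Ω n → ℝ} {X₀ : ℕ → Ω₀ → ℝ} (hind : ∀ n, iIndepFun (X n) (P n))
    (hid : ∀ n i, IdentDistrib (X n i) (X₀ n) (P n) P₀) (hX₀ : ∀ n, AEMeasurable (X₀ n) P₀)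
    {ε : ℕ → ℝ} (hε : Tendsto ε atTop (𝓝 0)) (h0 : ∀ n ω, 0 ≤ X₀ n ω) (hb : ∀ n ω, X₀ n ω ≤ ε n)
    (h1 : Tendsto (fun n : ℕ => (n : ℝ) * ∫ ω, X₀ n ω ∂P₀) atTop (𝓝 1)) {η : ℝ} (hη : 0 < η) :
    Tendsto (fun n => (P n).real {ω | η ≤ |∑ i, X n i ω - 1|}) atTop (𝓝 0) := by
  have hb' : ∀ n ω, |X₀ n ω| ≤ ε n := fun n ω => by rw [abs_of_nonneg (h0 n ω)]; exact hb n ω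
  have hL0 : ∀ n, MemLp (X₀ n) 2 P₀ := fun n =>
    .of_bound (hX₀ n).aestronglyMeasurable (ε n) (ae_of_all _ (hb' n))
  have hL : ∀ n i, MemLp (X n i) 2 (P n) := fun n i => (hid n i).memLp_iff.mpr (hL0 n)
  have hmean : ∀ n, ∫ ω, ∑ i, X n i ω ∂(P n) = (n : ℝ) * ∫ ω, X₀ n ω ∂P₀ := by
    intro n
    rw [integral_finsetSum _ fun i _ => (hL n i).integrable (by norm_num)]
    simp [(hid n _).integral_eq]
  -- The bounds `0 ≤ X ≤ ε` give `X² ≤ ε X`, so the variance is controlled by the mean.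
  have hvar : ∀ n, Var[fun ω => ∑ i, X n i ω; P n] ≤ ε n * ((n : ℝ) * ∫ ω, X₀ n ω ∂P₀) := by
    intro n
    have h : Var[∑ i, X n i; P n] = ∑ i, Var[X n i; P n] :=
      IndepFun.variance_sum (fun i _ => hL n i) fun i _ j _ hij => (hind n).indepFun hij
    rw [show (fun ω => ∑ i, X n i ω) = ∑ i, X n i by ext; simp, h]
    simp only [(hid n _).variance_eq, Finset.sum_const, Finset.card_univ, Fintype.card_fin,
      nsmul_eq_mul]
    rw [mul_left_comm]
    refine mul_le_mul_of_nonneg_left ?_ (Nat.cast_nonneg _)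
    refine (variance_le_expectation_sq (hX₀ n).aestronglyMeasurable).trans ?_
    rw [← integral_const_mul]
    refine integral_mono (hL0 n).integrable_sq
      (((hL0 n).integrable (by norm_num)).const_mul _) fun ω => ?_
    simp only [Pi.pow_apply, sq]
    exact mul_le_mul_of_nonneg_right (hb n ω) (h0 n ω)
  have hlim : Tendsto (fun n : ℕ => ε n * ((n : ℝ) * ∫ ω, X₀ n ω ∂P₀) / (η / 2) ^ 2) atTop
      (𝓝 0) := by
    simpa using (hε.mul h1).div_const ((η / 2) ^ 2)
  refine squeeze_zero' (Eventually.of_forall fun _ => measureReal_nonneg) ?_ hlim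
  filter_upwards [(tendsto_iff_dist_tendsto_zero.mp h1).eventually_lt_const (half_pos hη)] with n hn
  rw [Real.dist_eq] at hn
  have hsub : {ω | η ≤ |∑ i, X n i ω - 1|} ⊆
      {ω | η / 2 ≤ |∑ i, X n i ω - ∫ ω', ∑ i, X n i ω' ∂(P n)|} := by
    intro ω hω
    simp only [Set.mem_ofPred_eq, hmean] at hω ⊢
    have := abs_sub_le (∑ i, X n i ω) ((n : ℝ) * ∫ ω, X₀ n ω ∂P₀) 1
    linarith
  have hLs : MemLp (fun ω => ∑ i, X n i ω) 2 (P n) := memLp_finsetSum _ fun i _ => hL n i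
  refine (measureReal_mono hsub).trans ?_
  have hch := meas_ge_le_variance_div_sq hLs (half_pos hη)
  refine (ENNReal.toReal_le_of_le_ofReal ?_ hch).trans ?_
  · exact div_nonneg (variance_nonneg _ _) (sq_nonneg _)
  · exact div_le_div_of_nonneg_right (hvar n) (sq_nonneg _)

end TriangularArray

/-! ### Slutsky's theorem on varying probability spaces -/

section Slutsky

variable {Ω : ℕ → Type*} [∀ n, MeasurableSpace (Ω n)] {P : ∀ n, Measure (Ω n)}
  [∀ n, IsProbabilityMeasure (P n)] {Ω' : Type*} [MeasurableSpace Ω'] {P' : Measure Ω'}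
  [IsProbabilityMeasure P']

/-- Convergence in distribution on varying probability spaces can be tested on their product. -/
lemma tendstoInDistribution_infinitePi_iff {E : Type*} [TopologicalSpace E] [MeasurableSpace E]
    [OpensMeasurableSpace E] {X : ∀ n, Ω n → E} (hX : ∀ n, AEMeasurable (X n) (P n))
    {Z : Ω' → E} :
    TendstoInDistribution (fun n (ω : ∀ n, Ω n) => X n (ω n)) atTop Z
      (fun _ => Measure.infinitePi P) P' ↔ TendstoInDistribution X atTop Z P P' := by
  have hmp := fun n => measurePreserving_eval_infinitePi P n
  have hX' : ∀ n, AEMeasurable (fun ω : ∀ n, Ω n => X n (ω n)) (Measure.infinitePi P) :=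
    fun n => (hX n).comp_quasiMeasurePreserving (hmp n).quasiMeasurePreserving
  have hmap : ∀ n, (Measure.infinitePi P).map (fun ω : ∀ n, Ω n => X n (ω n)) =
      (P n).map (X n) := by
    intro n
    have h := AEMeasurable.map_map_of_aemeasurable (μ := Measure.infinitePi P)
      (f := fun ω : ∀ n, Ω n => ω n) (g := X n)
      (by rw [(hmp n).map_eq]; exact hX n) (hmp n).measurable.aemeasurable
    rw [(hmp n).map_eq] at h
    exact h.symm
  constructor
  · rintro ⟨h1, h2, h3⟩
    exact ⟨hX, h2, h3.congr fun n => Subtype.ext (hmap n)⟩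
  · rintro ⟨h1, h2, h3⟩
    exact ⟨hX', h2, h3.congr fun n => Subtype.ext (hmap n).symm⟩

/-- **Slutsky's theorem** for quotients, on varying probability spaces. -/
lemma MeasureTheory.TendstoInDistribution.div_of_tendsto_one {X R : ∀ n, Ω n → ℝ} {Z : Ω' → ℝ}
    (hXZ : TendstoInDistribution X atTop Z P P') (hR : ∀ n, AEMeasurable (R n) (P n))
    (hR1 : ∀ η > 0, Tendsto (fun n => (P n).real {ω | η ≤ |R n ω - 1|}) atTop (𝓝 0)) :
    TendstoInDistribution (fun n ω => X n ω / R n ω) atTop Z P P' := by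
  have hmp := fun n => measurePreserving_eval_infinitePi P n
  -- Only the law at each `n` matters, so everything may be moved to the product space, where
  -- convergence in measure to a constant makes sense.
  have hinv : TendstoInMeasure (Measure.infinitePi P) (fun n (ω : ∀ n, Ω n) => (R n (ω n))⁻¹)
      atTop fun _ => (1 : ℝ) := by
    rw [tendstoInMeasure_iff_measureReal_norm]
    intro η hη
    -- If `|R - 1|` is below both bounds, then `R > 1 / 2` and `|R⁻¹ - 1| = |1 - R| / R < η`.
    have hη' : 0 < min (1 / 2) (η / 2) := by positivity
    refine squeeze_zero (fun _ => measureReal_nonneg) (fun n => ?_) (hR1 _ hη')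
    have hnull : NullMeasurableSet {ω | min (1 / 2) (η / 2) ≤ |R n ω - 1|} (P n) :=
      nullMeasurableSet_le aemeasurable_const ((hR n).sub_const 1).abs
    have hpre : (P n).real {ω | min (1 / 2) (η / 2) ≤ |R n ω - 1|} = (Measure.infinitePi P).real
        ((fun ω : ∀ n, Ω n => ω n) ⁻¹' {ω | min (1 / 2) (η / 2) ≤ |R n ω - 1|}) := by
      rw [measureReal_def, measureReal_def, (hmp n).measure_preimage hnull]
    rw [hpre]
    refine measureReal_mono fun ω hω => ?_
    simp only [Set.mem_ofPred_eq, Set.mem_preimage, Real.norm_eq_abs] at hω ⊢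
    by_contra! hlt
    have h1 : |R n (ω n) - 1| < 1 / 2 := hlt.trans_le (min_le_left _ _)
    have h2 : |R n (ω n) - 1| < η / 2 := hlt.trans_le (min_le_right _ _)
    have hpos : 1 / 2 < R n (ω n) := by linarith [(abs_lt.mp h1).1]
    have hne : R n (ω n) ≠ 0 := by linarith
    have e : (R n (ω n))⁻¹ - 1 = (1 - R n (ω n)) / R n (ω n) := by field_simp
    rw [e, abs_div, abs_sub_comm, abs_of_pos (by linarith : 0 < R n (ω n)),
      le_div_iff₀ (by linarith)] at hω
    nlinarith
  refine (tendstoInDistribution_infinitePi_iff fun n =>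
    (hXZ.forall_aemeasurable n).div (hR n)).mp ?_
  have h := ((tendstoInDistribution_infinitePi_iff hXZ.forall_aemeasurable).mpr
    hXZ).continuous_comp_prodMk_of_tendstoInMeasure_const (g := fun p : ℝ × ℝ => p.1 * p.2)
    (by fun_prop) hinv fun n => (hR n).inv.comp_quasiMeasurePreserving (hmp n).quasiMeasurePreserving
  simpa [div_eq_mul_inv] using h

end Slutsky

/-! ### Weighted counts of nested indicators -/

/-- A sequence of row-wise i.i.d. arrays of nested `0`-`1` vectors whose weighted expected counts
`n (j + 1) p_j` all agree with a diverging normalisation `a n` up to `o(√(a n))`. -/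
structure IsNestedIndicatorArray {Ω₀ : Type*} [MeasurableSpace Ω₀] (P₀ : Measure Ω₀)
    {Ω : ℕ → Type*} [∀ n, MeasurableSpace (Ω n)] (P : ∀ n, Measure (Ω n)) (k : ℕ)
    (E : ∀ n, Fin n → Ω n → ℕ → ℝ) (E₀ : ℕ → Ω₀ → ℕ → ℝ) (a : ℕ → ℝ) : Prop where
  indep : ∀ n, iIndepFun (E n) (P n)
  identDistrib : ∀ n i, IdentDistrib (E n i) (E₀ n) (P n) P₀
  aemeasurable : ∀ n, AEMeasurable (E₀ n) P₀
  zero_or_one : ∀ n ω j, E₀ n ω j = 0 ∨ E₀ n ω j = 1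
  nested : ∀ᶠ n in atTop, ∀ ω j l, j ≤ l → E₀ n ω j * E₀ n ω l = E₀ n ω l
  pos : ∀ n, 0 < a n
  tendsto_atTop : Tendsto a atTop atTop
  mean : ∀ j < k, Tendsto (fun n : ℕ =>
    ((n : ℝ) * ((j + 1 : ℕ) * ∫ ω, E₀ n ω j ∂P₀) - a n) / √(a n)) atTop (𝓝 0)

namespace IsNestedIndicatorArray

variable {Ω₀ : Type*} [MeasurableSpace Ω₀] {P₀ : Measure Ω₀}
  {Ω : ℕ → Type*} [∀ n, MeasurableSpace (Ω n)] {P : ∀ n, Measure (Ω n)} {k : ℕ}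
  {E : ∀ n, Fin n → Ω n → ℕ → ℝ} {E₀ : ℕ → Ω₀ → ℕ → ℝ} {a : ℕ → ℝ}

lemma abs_le_one (h : IsNestedIndicatorArray P₀ P k E E₀ a) (n : ℕ) (ω : Ω₀) (j : ℕ) :
    |E₀ n ω j| ≤ 1 := by
  rcases h.zero_or_one n ω j with h | h <;> simp [h]

lemma nonneg (h : IsNestedIndicatorArray P₀ P k E E₀ a) (n : ℕ) (ω : Ω₀) (j : ℕ) :
    0 ≤ E₀ n ω j := by
  rcases h.zero_or_one n ω j with h | h <;> simp [h]

lemma tendsto_mean_div (h : IsNestedIndicatorArray P₀ P k E E₀ a) {j : ℕ} (hj : j < k) :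
    Tendsto (fun n : ℕ => (n : ℝ) * ((j + 1 : ℕ) * ∫ ω, E₀ n ω j ∂P₀) / a n) atTop (𝓝 1) := by
  have hs : Tendsto (fun n => (√(a n))⁻¹) atTop (𝓝 0) :=
    tendsto_inv_atTop_zero.comp (Real.tendsto_sqrt_atTop.comp h.tendsto_atTop)
  have := ((h.mean j hj).mul hs).const_add 1
  rw [mul_zero, add_zero] at this
  refine this.congr fun n => ?_
  have ha := (h.pos n).ne'
  have hsq : √(a n) * √(a n) = a n := Real.mul_self_sqrt (h.pos n).le
  rw [← div_eq_mul_inv, div_div, hsq]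
  field_simp
  ring

lemma tendsto_inv_sqrt (h : IsNestedIndicatorArray P₀ P k E E₀ a) :
    Tendsto (fun n => (√(a n))⁻¹) atTop (𝓝 0) :=
  tendsto_inv_atTop_zero.comp (Real.tendsto_sqrt_atTop.comp h.tendsto_atTop)

variable [IsProbabilityMeasure P₀]

lemma integrable (h : IsNestedIndicatorArray P₀ P k E E₀ a) (n j : ℕ) :
    Integrable (fun ω => E₀ n ω j) P₀ := by
  refine .of_bound (C := 1) ?_ (ae_of_all _ fun ω => ?_)
  · exact ((measurable_pi_apply j).comp_aemeasurable (h.aemeasurable n)).aestronglyMeasurable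
  · rcases h.zero_or_one n ω j with h | h <;> simp [h]

/-- Limit of the characteristic functions of the normalised contrasts of the weighted counts. -/
lemma tendsto_charFun_contrast (h : IsNestedIndicatorArray P₀ P k E E₀ a) {β : ℕ → ℝ}
    (hβ : ∑ j ∈ Finset.range k, β j = 0) :
    Tendsto (fun n => charFun ((P n).map fun ω => ∑ i, (∑ j ∈ Finset.range k,
        β j * ((j + 1 : ℕ) * E n i ω j)) / √(a n)) 1) atTop
      (𝓝 (Complex.exp (-((∑ j ∈ Finset.range k, ∑ l ∈ Finset.range k,
        β j * β l * (min (j + 1) (l + 1) : ℕ) : ℝ) : ℂ) / 2))) := by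
  have hg : ∀ n, Measurable fun x : ℕ → ℝ =>
      (∑ j ∈ Finset.range k, β j * ((j + 1 : ℕ) * x j)) / √(a n) := fun n => by fun_prop
  refine tendsto_charFun_sum_of_bounded_array (P₀ := P₀)
    (X := fun n i ω => (∑ j ∈ Finset.range k, β j * ((j + 1 : ℕ) * E n i ω j)) / √(a n))
    (X₀ := fun n ω => (∑ j ∈ Finset.range k, β j * ((j + 1 : ℕ) * E₀ n ω j)) / √(a n))
    (ε := fun n => (∑ j ∈ Finset.range k, |β j| * (j + 1 : ℕ)) * (√(a n))⁻¹)
    (fun n => (h.indep n).comp _ fun _ => hg n) (fun n i => (h.identDistrib n i).comp (hg n))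
    (fun n => (hg n).comp_aemeasurable (h.aemeasurable n)) ?_ ?_ ?_ ?_
  · simpa using h.tendsto_inv_sqrt.const_mul (∑ j ∈ Finset.range k, |β j| * (j + 1 : ℕ))
  · intro n ω
    rw [abs_div, abs_of_nonneg (Real.sqrt_nonneg _), div_eq_mul_inv]
    refine mul_le_mul_of_nonneg_right ?_ (by positivity)
    refine (Finset.abs_sum_le_sum_abs _ _).trans (Finset.sum_le_sum fun j _ => ?_)
    rw [abs_mul, abs_mul, Nat.abs_cast]
    have := h.abs_le_one n ω j
    gcongr
    exact mul_le_of_le_one_right (by positivity) this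
  -- As `∑ β_j = 0`, the common centring `a n` may be subtracted from every weighted mean.
  · have hlim : Tendsto (fun n : ℕ => ∑ j ∈ Finset.range k, β j *
        (((n : ℝ) * ((j + 1 : ℕ) * ∫ ω, E₀ n ω j ∂P₀) - a n) / √(a n))) atTop (𝓝 0) := by
      rw [← Finset.sum_const_zero (s := Finset.range k)]
      refine tendsto_finsetSum _ fun j hj => ?_
      simpa using (h.mean j (Finset.mem_range.mp hj)).const_mul (β j)
    refine hlim.congr fun n => ?_
    rw [integral_div, integral_finsetSum _ fun j _ => ((h.integrable n j).const_mul _).const_mul _]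
    simp only [integral_const_mul]
    rw [← mul_div_assoc, Finset.mul_sum, ← sub_zero (∑ j ∈ Finset.range k, (n : ℝ) * _),
      ← zero_mul (a n), ← hβ, Finset.sum_mul, ← Finset.sum_sub_distrib, Finset.sum_div]
    exact Finset.sum_congr rfl fun j _ => by ring
  -- Nesting turns a product of indicators into the one of larger index, and `(j + 1) (l + 1)`
  -- splits as min times max; the max is absorbed by the weighted mean, which is asymptotic to `a
  -- n`.
  · have hlim : Tendsto (fun n : ℕ => ∑ j ∈ Finset.range k, ∑ l ∈ Finset.range k,
        β j * β l * (min (j + 1) (l + 1) : ℕ) *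
        ((n : ℝ) * ((max j l + 1 : ℕ) * ∫ ω, E₀ n ω (max j l) ∂P₀) / a n)) atTop
        (𝓝 (∑ j ∈ Finset.range k, ∑ l ∈ Finset.range k,
          β j * β l * (min (j + 1) (l + 1) : ℕ))) := by
      refine tendsto_finsetSum _ fun j hj => tendsto_finsetSum _ fun l hl => ?_
      have hm : max j l < k := max_lt (Finset.mem_range.mp hj) (Finset.mem_range.mp hl)
      simpa using (h.tendsto_mean_div hm).const_mul (β j * β l * (min (j + 1) (l + 1) : ℕ))
    refine hlim.congr' ?_
    filter_upwards [h.nested] with n hn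
    have hmax : ∀ ω j l, E₀ n ω j * E₀ n ω l = E₀ n ω (max j l) := by
      intro ω j l
      rcases le_total j l with hjl | hjl
      · rw [max_eq_right hjl, hn ω j l hjl]
      · rw [max_eq_left hjl, mul_comm, hn ω l j hjl]
    have hsq : ∀ ω, ((∑ j ∈ Finset.range k, β j * ((j + 1 : ℕ) * E₀ n ω j)) / √(a n)) ^ 2 =
        ∑ j ∈ Finset.range k, ∑ l ∈ Finset.range k, β j * β l * (min (j + 1) (l + 1) : ℕ) *
          ((max j l + 1 : ℕ) / a n) * E₀ n ω (max j l) := by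
      intro ω
      rw [div_pow, Real.sq_sqrt (h.pos n).le, sq, Finset.sum_mul_sum, Finset.sum_div]
      refine Finset.sum_congr rfl fun j _ => ?_
      rw [Finset.sum_div]
      refine Finset.sum_congr rfl fun l _ => ?_
      rw [← hmax]
      have : ((j + 1 : ℕ) : ℝ) * (l + 1 : ℕ) = (min (j + 1) (l + 1) : ℕ) * (max j l + 1 : ℕ) := by
        rw [← Nat.cast_mul, ← Nat.cast_mul, show max j l + 1 = max (j + 1) (l + 1) by omega,
          min_mul_max]
      linear_combination (β j * β l * E₀ n ω j * E₀ n ω l / a n) * this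
    simp_rw [hsq]
    rw [integral_finsetSum _ fun j _ => integrable_finsetSum _ fun l _ =>
      (h.integrable n _).const_mul _, Finset.mul_sum]
    refine Finset.sum_congr rfl fun j _ => ?_
    rw [integral_finsetSum _ fun l _ => (h.integrable n _).const_mul _, Finset.mul_sum]
    refine Finset.sum_congr rfl fun l _ => ?_
    rw [integral_const_mul]
    ring

/-- The normalised diagonalising contrasts are asymptotically standard normal. -/
lemma tendstoInDistribution_contrasts [∀ n, IsProbabilityMeasure (P n)]
    (h : IsNestedIndicatorArray P₀ P k E E₀ a) {Ω' : Type*} [MeasurableSpace Ω']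
    {P' : Measure Ω'} [IsProbabilityMeasure P'] {ξ : Fin (k - 1) → Ω' → ℝ}
    (hξind : iIndepFun ξ P') (hξ : ∀ i, HasLaw (ξ i) (gaussianReal 0 1) P') :
    TendstoInDistribution (fun n ω => WithLp.toLp 2 fun i : Fin (k - 1) =>
        (∑ j ∈ Finset.range k, diagCoeff k i j * ((j + 1 : ℕ) * ∑ m, E n m ω j)) / √(a n))
      atTop (fun ω => WithLp.toLp 2 fun i => ξ i ω) P P' := by
  have hEm : ∀ n m j, AEMeasurable (fun ω => E n m ω j) (P n) := fun n m j =>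
    (measurable_pi_apply j).comp_aemeasurable (h.identDistrib n m).aemeasurable_fst
  have hξm : ∀ i, AEMeasurable (ξ i) P' := fun i => (hξ i).aemeasurable
  have hYm : ∀ n, AEMeasurable (fun ω => WithLp.toLp 2 fun i : Fin (k - 1) =>
      (∑ j ∈ Finset.range k, diagCoeff k i j * ((j + 1 : ℕ) * ∑ m, E n m ω j)) / √(a n))
      (P n) := by
    intro n
    refine (WithLp.measurable_toLp 2 _).comp_aemeasurable (aemeasurable_pi_lambda _ fun i => ?_)
    fun_prop
  refine ⟨hYm, by fun_prop, ProbabilityMeasure.tendsto_iff_tendsto_charFun.2 fun θ => ?_⟩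
  simp only [ProbabilityMeasure.coe_mk]
  rw [(iIndepFun_iff_charFun_pi hξm).mp hξind θ]
  -- Cramér–Wold: the pairing with `θ` is again a contrast, so the scalar limit applies, and
  -- diagonalisation makes its variance `∑ θ_i²`.
  have hθ : ∑ j ∈ Finset.range k, (∑ i : Fin (k - 1), θ i * diagCoeff k i j) = 0 := by
    rw [Finset.sum_comm]
    refine Finset.sum_eq_zero fun i _ => ?_
    rw [← Finset.mul_sum, sum_diagCoeff_eq_zero i.2, mul_zero]
  have hlim := h.tendsto_charFun_contrast hθ
  have hvar : ∑ j ∈ Finset.range k, ∑ l ∈ Finset.range k,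
      (∑ i : Fin (k - 1), θ i * diagCoeff k i j) * (∑ i : Fin (k - 1), θ i * diagCoeff k i l) *
        (min (j + 1) (l + 1) : ℕ) = ∑ i, θ i ^ 2 := by
    calc _ = ∑ i : Fin (k - 1), ∑ i' : Fin (k - 1), θ i * θ i' *
          ∑ j ∈ Finset.range k, ∑ l ∈ Finset.range k,
            diagCoeff k i j * diagCoeff k i' l * (min (j + 1) (l + 1) : ℕ) := by
          simp_rw [Finset.sum_mul_sum, Finset.sum_mul, Finset.mul_sum]
          rw [Finset.sum_congr rfl fun j _ => Finset.sum_comm, Finset.sum_comm]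
          refine Finset.sum_congr rfl fun i _ => ?_
          rw [Finset.sum_congr rfl fun j _ => Finset.sum_comm, Finset.sum_comm]
          refine Finset.sum_congr rfl fun i' _ => Finset.sum_congr rfl fun j _ =>
            Finset.sum_congr rfl fun l _ => by ring
      _ = _ := by
          simp_rw [sum_diagCoeff_mul_min]
          simp [sq]
  rw [hvar] at hlim
  have hR : ∏ i, charFun (P'.map (ξ i)) (θ i) =
      Complex.exp (-((∑ i, θ i ^ 2 : ℝ) : ℂ) / 2) := by
    simp_rw [fun i => (hξ i).map_eq, charFun_gaussianReal]
    rw [← Complex.exp_sum]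
    congr 1
    push_cast
    rw [neg_div, Finset.sum_div, ← Finset.sum_neg_distrib]
    exact Finset.sum_congr rfl fun i _ => by simp
  rw [hR]
  refine hlim.congr fun n => ?_
  rw [charFun_apply_real, charFun_apply, integral_map (by fun_prop) (by fun_prop),
    integral_map (hYm n) (by fun_prop)]
  refine integral_congr_ae (ae_of_all _ fun ω => ?_)
  simp only [Complex.ofReal_one, one_mul]
  congr 3
  rw [PiLp.inner_apply]
  simp only [RCLike.inner_apply, conj_trivial]
  simp_rw [← Finset.sum_div, Finset.mul_sum, Finset.sum_mul, ← mul_div_assoc, ← Finset.sum_div]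
  congr 1
  rw [Finset.sum_comm, Finset.sum_congr rfl fun j _ => Finset.sum_comm, Finset.sum_comm]
  simp_rw [Finset.mul_sum]
  refine Finset.sum_congr rfl fun i _ => Finset.sum_congr rfl fun j _ =>
    Finset.sum_congr rfl fun m _ => by ring

/-- Law of large numbers for the average weighted count. -/
lemma tendsto_measureReal_mean [∀ n, IsProbabilityMeasure (P n)]
    (h : IsNestedIndicatorArray P₀ P k E E₀ a) (hk : 1 ≤ k) {η : ℝ} (hη : 0 < η) :
    Tendsto (fun n => (P n).real {ω | η ≤ |(1 / (k : ℝ) * ∑ l ∈ Finset.range k,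
      (l + 1 : ℕ) * ∑ m, E n m ω l) / a n - 1|}) atTop (𝓝 0) := by
  have hg : ∀ n, Measurable fun x : ℕ → ℝ =>
      (1 / (k : ℝ) * ∑ l ∈ Finset.range k, (l + 1 : ℕ) * x l) / a n := fun n => by fun_prop
  have hk0 : (k : ℝ) ≠ 0 := by positivity
  have key := tendsto_measureReal_sum_sub_one_of_bounded_array (P₀ := P₀) (P := P)
    (X := fun n i ω => (1 / (k : ℝ) * ∑ l ∈ Finset.range k, (l + 1 : ℕ) * E n i ω l) / a n)
    (X₀ := fun n ω => (1 / (k : ℝ) * ∑ l ∈ Finset.range k, (l + 1 : ℕ) * E₀ n ω l) / a n)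
    (ε := fun n => (1 / (k : ℝ) * ∑ l ∈ Finset.range k, ((l + 1 : ℕ) : ℝ)) * (a n)⁻¹)
    (fun n => (h.indep n).comp _ fun _ => hg n) (fun n i => (h.identDistrib n i).comp (hg n))
    (fun n => (hg n).comp_aemeasurable (h.aemeasurable n)) ?_ ?_ ?_ ?_ hη
  · refine key.congr fun n => ?_
    congr 1
    ext ω
    simp only [Set.mem_ofPred_eq]
    rw [← Finset.sum_div, ← Finset.mul_sum, Finset.sum_comm]
    simp_rw [Finset.mul_sum]
  · simpa using (tendsto_inv_atTop_zero.comp h.tendsto_atTop).const_mul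
      (1 / (k : ℝ) * ∑ l ∈ Finset.range k, ((l + 1 : ℕ) : ℝ))
  · intro n ω
    have := h.nonneg n ω
    have := (h.pos n).le
    exact div_nonneg (mul_nonneg (by positivity) (Finset.sum_nonneg fun l _ =>
      mul_nonneg (by positivity) (h.nonneg n ω l))) this
  · intro n ω
    have := h.pos n
    rw [div_eq_mul_inv]
    gcongr with l _
    exact mul_le_of_le_one_right (by positivity) (le_of_abs_le (h.abs_le_one n ω l))
  · have hlim : Tendsto (fun n : ℕ => 1 / (k : ℝ) * ∑ l ∈ Finset.range k,
        (n : ℝ) * ((l + 1 : ℕ) * ∫ ω, E₀ n ω l ∂P₀) / a n) atTop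
        (𝓝 (1 / (k : ℝ) * ∑ l ∈ Finset.range k, 1)) :=
      (tendsto_finsetSum _ fun l hl =>
        h.tendsto_mean_div (Finset.mem_range.mp hl)).const_mul _
    have e : 1 / (k : ℝ) * ∑ l ∈ Finset.range k, 1 = 1 := by simp [hk0]
    rw [e] at hlim
    refine hlim.congr fun n => ?_
    rw [integral_div, integral_const_mul,
      integral_finsetSum _ fun l _ => (h.integrable n l).const_mul _]
    simp only [integral_const_mul]
    rw [← Finset.sum_div, ← Finset.mul_sum]
    ring

/-- Limit distribution of the normalised dispersion of the weighted counts. -/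
theorem tendstoInDistribution_dispersion [∀ n, IsProbabilityMeasure (P n)]
    (h : IsNestedIndicatorArray P₀ P k E E₀ a) (hk : 1 ≤ k) {Ω' : Type*} [MeasurableSpace Ω']
    {P' : Measure Ω'} [IsProbabilityMeasure P'] {ξ : Fin (k - 1) → Ω' → ℝ}
    (hξind : iIndepFun ξ P') (hξ : ∀ i, HasLaw (ξ i) (gaussianReal 0 1) P') :
    TendstoInDistribution (fun n ω => (∑ j ∈ Finset.range k, ((j + 1 : ℕ) * ∑ m, E n m ω j -
        1 / (k : ℝ) * ∑ l ∈ Finset.range k, (l + 1 : ℕ) * ∑ m, E n m ω l) ^ 2) /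
        (1 / (k : ℝ) * ∑ l ∈ Finset.range k, (l + 1 : ℕ) * ∑ m, E n m ω l))
      atTop (fun ω => ∑ i : Fin (k - 1), limitWeight k (i + 1) * ξ i ω ^ 2) P P' := by
  have hEm : ∀ n m j, AEMeasurable (fun ω => E n m ω j) (P n) := fun n m j =>
    (measurable_pi_apply j).comp_aemeasurable (h.identDistrib n m).aemeasurable_fst
  have hQ := (h.tendstoInDistribution_contrasts hξind hξ).continuous_comp
    (g := fun y : EuclideanSpace ℝ (Fin (k - 1)) =>
      ∑ i : Fin (k - 1), limitWeight k (i + 1) * y i ^ 2)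
    (by fun_prop)
  have hdiv := hQ.div_of_tendsto_one (R := fun n ω => (1 / (k : ℝ) * ∑ l ∈ Finset.range k,
      (l + 1 : ℕ) * ∑ m, E n m ω l) / a n) (fun n => by fun_prop)
    (fun η hη => h.tendsto_measureReal_mean hk hη)
  refine hdiv.congr (fun n => ae_of_all _ fun ω => ?_) (ae_of_all _ fun ω => rfl)
  have ha := h.pos n
  simp only [Function.comp_apply]
  rw [sum_sub_mean_sq_eq_sum_limitWeight hk fun j => (j + 1 : ℕ) * ∑ m, E n m ω j]
  simp_rw [div_pow, Real.sq_sqrt ha.le, ← mul_div_assoc]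
  -- The unknown normalisation `a n` cancels from the quotient.
  rw [← Finset.sum_div, div_div_div_cancel_right₀ ha.ne']

end IsNestedIndicatorArray

/-! ### Exceedance indicators on a grid -/

lemma indicator_discreteSojourn_eq_one_iff (d : ℕ) (u : ℕ → ℝ) (s : ℝ) :
    (Set.Ioi (0 : ℝ)).indicator (fun _ => (1 : ℝ)) (discreteSojourn d u s) = 1 ↔
      ∃ r ∈ Finset.Icc 1 d, s < u r - 1 := by
  have h : 0 < discreteSojourn d u s ↔ ∃ r ∈ Finset.Icc 1 d, s < u r - 1 := by
    rw [discreteSojourn, Finset.sum_pos_iff_of_nonneg fun r _ =>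
      Set.indicator_nonneg (fun _ _ => zero_le_one) _]
    refine exists_congr fun r => and_congr_right fun _ => ?_
    by_cases hr : s < u r - 1 <;> simp [Set.indicator, hr]
  rw [← h]
  by_cases h0 : 0 < discreteSojourn d u s <;> simp [Set.indicator, h0]

/-- The exceedance indicators of a path at the levels `1 - c / (j + 1)` on a grid. -/
noncomputable def exceedanceIndicator (d : ℕ) (t : ℕ → I) (c : ℝ) (u : I → ℝ) (j : ℕ) : ℝ :=
  (Set.Ioi (0 : ℝ)).indicator (fun _ => (1 : ℝ))
    (discreteSojourn d (fun r => u (t r)) (-(c / (j + 1 : ℕ))))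

lemma exceedanceIndicator_eq_one_iff {d : ℕ} {t : ℕ → I} {c : ℝ} {u : I → ℝ} {j : ℕ} :
    exceedanceIndicator d t c u j = 1 ↔
      ∃ r ∈ Finset.Icc 1 d, -(c / (j + 1 : ℕ)) < u (t r) - 1 :=
  indicator_discreteSojourn_eq_one_iff d _ _

lemma exceedanceIndicator_zero_or_one (d : ℕ) (t : ℕ → I) (c : ℝ) (u : I → ℝ) (j : ℕ) :
    exceedanceIndicator d t c u j = 0 ∨ exceedanceIndicator d t c u j = 1 :=
  Set.indicator_eq_zero_or_self _ _ _

/-- For `c ≥ 0` the level `1 - c / (j + 1)` increases with `j`, so exceeding level `l` forces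
exceeding level `j`. -/
lemma exceedanceIndicator_mul {d : ℕ} {t : ℕ → I} {c : ℝ} (hc : 0 ≤ c) {u : I → ℝ} {j l : ℕ}
    (hjl : j ≤ l) :
    exceedanceIndicator d t c u j * exceedanceIndicator d t c u l =
      exceedanceIndicator d t c u l := by
  rcases exceedanceIndicator_zero_or_one d t c u l with h | h
  · rw [h, mul_zero]
  · have hj : exceedanceIndicator d t c u j = 1 := by
      rw [exceedanceIndicator_eq_one_iff] at h ⊢
      obtain ⟨r, hr, hlt⟩ := h
      refine ⟨r, hr, lt_of_le_of_lt ?_ hlt⟩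
      gcongr
    rw [hj, one_mul]

lemma measurable_exceedanceIndicator (d : ℕ) (t : ℕ → I) (c : ℝ) :
    Measurable (exceedanceIndicator d t c) := by
  refine measurable_pi_lambda _ fun j => ?_
  refine (measurable_const.indicator measurableSet_Ioi).comp (Finset.measurable_sum _ fun r _ => ?_)
  exact (measurable_const.indicator measurableSet_Ioi).comp
    ((measurable_pi_apply (t r)).sub_const 1)

/-- The function that is `-1` on the grid points and `0` elsewhere. -/
noncomputable def gridFunction (d : ℕ) (t : ℕ → I) : I → ℝ :=
  (t '' Set.Icc 1 d).indicator fun _ => -1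

lemma abs_gridFunction_le_one (d : ℕ) (t : ℕ → I) (s : I) : |gridFunction d t s| ≤ 1 := by
  rw [gridFunction]
  by_cases h : s ∈ t '' Set.Icc 1 d <;> simp [Set.indicator, h]

lemma gridFunction_mem_EMinus (d : ℕ) (t : ℕ → I) : gridFunction d t ∈ EMinus := by
  have hfin : (t '' Set.Icc 1 d).Finite := (Set.finite_Icc 1 d).image t
  refine ⟨⟨1, abs_gridFunction_le_one d t⟩, hfin.subset fun s hs => ?_, fun s => ?_⟩
  · by_contra hs'
    refine hs ?_
    have : gridFunction d t =ᶠ[𝓝 s] fun _ => 0 := by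
      filter_upwards [hfin.isClosed.isOpen_compl.mem_nhds hs'] with x hx
      exact Set.indicator_of_notMem hx _
    exact continuousAt_const.congr this.symm
  · rw [gridFunction]
    by_cases h : s ∈ t '' Set.Icc 1 d <;> simp [Set.indicator, h]

/-! ### Exceedance probabilities of a copula process -/

section Copula

variable {Ω : Type*} [MeasurableSpace Ω] {P : Measure Ω} {U : I → Ω → ℝ}

/-- The bound holds almost surely at each point of a countable dense set, and continuity of the
paths extends it to all points at once. -/
lemma IsCopulaProcess.ae_le_one (hU : IsCopulaProcess U P) : ∀ᵐ ω ∂P, ∀ s, U s ω ≤ 1 := by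
  have h1 : ∀ s, ∀ᵐ ω ∂P, U s ω ≤ 1 := by
    intro s
    have h := (hU.uniform s).measure_preimage (μ := volume) (by simp) (by simp)
      (A := Set.Ioi 1) measurableSet_Ioi
    have he : Set.Ioo (0 : ℝ) 1 ∩ Set.Ioi 1 = ∅ := by
      ext x; simp; intro _ h; exact h.le
    rw [he, measure_empty, ENNReal.zero_div] at h
    rw [ae_iff]
    convert h using 2
    ext ω; simp
  have h2 : ∀ᵐ ω ∂P, ∀ m, U (TopologicalSpace.denseSeq I m) ω ≤ 1 := ae_all_iff.mpr fun m => h1 _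
  filter_upwards [h2] with ω hω s
  have hcl : IsClosed {s | U s ω ≤ 1} := isClosed_le (hU.continuous ω) continuous_const
  have : closure (Set.range (TopologicalSpace.denseSeq I)) ⊆ {s | U s ω ≤ 1} :=
    hcl.closure_subset_iff.mpr (by rintro _ ⟨m, rfl⟩; exact hω m)
  exact this (TopologicalSpace.denseRange_denseSeq I s)

lemma IsCopulaProcess.measureReal_gt (hU : IsCopulaProcess U P) (s : I) {c : ℝ} (hc0 : 0 ≤ c)
    (hc1 : c ≤ 1) : P.real {ω | 1 - c < U s ω} = c := by
  have h := (hU.uniform s).measure_preimage (μ := volume) (by simp) (by simp)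
    (A := Set.Ioi (1 - c)) measurableSet_Ioi
  have he : Set.Ioo (0 : ℝ) 1 ∩ Set.Ioi (1 - c) = Set.Ioo (1 - c) 1 := by
    ext x; simp; constructor
    · rintro ⟨⟨_, h⟩, h'⟩; exact ⟨h', h⟩
    · rintro ⟨h', h⟩; exact ⟨⟨by linarith, h⟩, h'⟩
  rw [he, Real.volume_Ioo, Real.volume_Ioo, sub_sub_cancel, sub_zero, ENNReal.ofReal_one,
    div_one] at h
  rw [measureReal_def, show {ω | 1 - c < U s ω} = U s ⁻¹' Set.Ioi (1 - c) from rfl, h,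
    ENNReal.toReal_ofReal hc0]

lemma integral_exceedanceIndicator (hU : IsCopulaProcess U P) (d : ℕ) (t : ℕ → I) (c : ℝ) (j : ℕ) :
    ∫ ω, exceedanceIndicator d t c (fun s => U s ω) j ∂P =
      P.real {ω | ∃ r ∈ Finset.Icc 1 d, -(c / (j + 1 : ℕ)) < U (t r) ω - 1} := by
  have hm : Measurable fun ω s => U s ω := measurable_pi_lambda _ hU.measurable
  have hme : Measurable fun ω => exceedanceIndicator d t c (fun s => U s ω) j :=
    (measurable_pi_apply j).comp ((measurable_exceedanceIndicator d t c).comp hm)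
  have hs : {ω | ∃ r ∈ Finset.Icc 1 d, -(c / (j + 1 : ℕ)) < U (t r) ω - 1} =
      (fun ω => exceedanceIndicator d t c (fun s => U s ω) j) ⁻¹' {1} := by
    ext ω
    simp only [Set.mem_preimage, Set.mem_singleton_iff, exceedanceIndicator_eq_one_iff]
    rfl
  rw [hs, ← integral_indicator_one (hme (measurableSet_singleton 1))]
  refine integral_congr_ae (ae_of_all _ fun ω => ?_)
  rcases exceedanceIndicator_zero_or_one d t c (fun s => U s ω) j with h | h <;>
    simp [Set.indicator, h]

variable [IsProbabilityMeasure P]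

lemma le_integral_exceedanceIndicator (hU : IsCopulaProcess U P) {d : ℕ} {t : ℕ → I}
    (hd : 1 ≤ d) {c : ℝ} (hc0 : 0 ≤ c) (hc1 : c ≤ 1) :
    c ≤ ∫ ω, exceedanceIndicator d t c (fun s => U s ω) 0 ∂P := by
  refine (hU.measureReal_gt (t 1) hc0 hc1).ge.trans ?_
  rw [integral_exceedanceIndicator hU]
  refine measureReal_mono fun ω hω => ⟨1, by simpa using hd, ?_⟩
  simp only [Set.mem_ofPred_eq] at hω
  simp only [zero_add, Nat.cast_one, div_one]
  linarith

/-- Off the grid the constraint is `U ≤ 1`, which holds almost surely; on the grid it says that no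
exceedance occurs. -/
lemma measureReal_le_gridFunction (hU : IsCopulaProcess U P) (d : ℕ) (t : ℕ → I) (c : ℝ) (j : ℕ) :
    P.real {ω | ∀ s, U s ω ≤ 1 + c / (j + 1 : ℕ) * gridFunction d t s} =
      1 - ∫ ω, exceedanceIndicator d t c (fun s => U s ω) j ∂P := by
  have hmeas : MeasurableSet
      {ω | ∃ r ∈ Finset.Icc 1 d, -(c / (j + 1 : ℕ)) < U (t r) ω - 1} := by
    have : {ω | ∃ r ∈ Finset.Icc 1 d, -(c / (j + 1 : ℕ)) < U (t r) ω - 1} =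
        ⋃ r ∈ Finset.Icc 1 d, {ω | -(c / (j + 1 : ℕ)) < U (t r) ω - 1} := by ext; simp
    rw [this]
    exact Finset.measurableSet_biUnion _ fun r _ =>
      measurableSet_lt measurable_const ((hU.measurable _).sub_const 1)
  rw [integral_exceedanceIndicator hU, ← probReal_compl_eq_one_sub hmeas]
  refine measureReal_congr ?_
  filter_upwards [hU.ae_le_one] with ω hω
  refine propext ?_
  change (∀ s, U s ω ≤ 1 + c / (j + 1 : ℕ) * gridFunction d t s) ↔
    ¬ ∃ r ∈ Finset.Icc 1 d, -(c / (j + 1 : ℕ)) < U (t r) ω - 1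
  push Not
  constructor
  · intro h r hr
    have := h (t r)
    rw [gridFunction, Set.indicator_of_mem (Set.mem_image_of_mem t (by simpa using hr))] at this
    linarith
  · intro h s
    by_cases hs : s ∈ t '' Set.Icc 1 d
    · obtain ⟨r, hr, rfl⟩ := hs
      have := h r (by simpa using hr)
      rw [gridFunction, Set.indicator_of_mem (Set.mem_image_of_mem t hr)]
      linarith
    · rw [gridFunction, Set.indicator_of_notMem hs]
      simpa using hω s

end Copula

/-- Uniform expansion of the grid exceedance probabilities. -/
lemma UniformDeltaNeighborhood.exists_abs_integral_exceedanceIndicator_sub_le {Ω Ω' : Type*}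
    [MeasurableSpace Ω] [MeasurableSpace Ω'] {P : Measure Ω} [IsProbabilityMeasure P]
    {Q : Measure Ω'} {U : I → Ω → ℝ} {Z : I → Ω' → ℝ} (hU : IsCopulaProcess U P) {δ : ℝ}
    (hδ : 0 < δ) (hUZ : UniformDeltaNeighborhood U P Z Q δ) :
    ∃ K : ℝ, 0 ≤ K ∧ ∀ᶠ c in 𝓝[>] (0 : ℝ), ∀ (d : ℕ) (t : ℕ → I) (j : ℕ),
      |(j + 1 : ℕ) * ∫ ω, exceedanceIndicator d t c (fun s => U s ω) j ∂P -
        c * dNorm Z Q (gridFunction d t)| ≤ K * (j + 1 : ℕ) * c ^ (1 + δ) := by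
  obtain ⟨K, hK⟩ := hUZ
  refine ⟨max K 0, le_max_right _ _, ?_⟩
  -- The expansion is needed at `c / (j + 1)` for all `j` simultaneously; an interval `(0, b)` is
  -- stable under these divisions.
  obtain ⟨b, hb0, hb⟩ := mem_nhdsGT_iff_exists_Ioo_subset.mp hK
  refine mem_nhdsGT_iff_exists_Ioo_subset.mpr ⟨b, hb0, fun c hc d t j => ?_⟩
  have hj : (1 : ℝ) ≤ (j + 1 : ℕ) := by exact_mod_cast Nat.succ_le_succ (Nat.zero_le j)
  have hj0 : (0 : ℝ) < (j + 1 : ℕ) := by linarith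
  have hcj : c / (j + 1 : ℕ) ≤ c := div_le_self hc.1.le hj
  have h := hb ⟨div_pos hc.1 hj0, hcj.trans_lt hc.2⟩ (gridFunction d t)
    (gridFunction_mem_EMinus d t) (abs_gridFunction_le_one d t)
  rw [measureReal_le_gridFunction hU, sub_sub_sub_cancel_left, abs_sub_comm] at h
  have e : (j + 1 : ℕ) * ∫ ω, exceedanceIndicator d t c (fun s => U s ω) j ∂P -
      c * dNorm Z Q (gridFunction d t) = (j + 1 : ℕ) *
      (∫ ω, exceedanceIndicator d t c (fun s => U s ω) j ∂P -
        c / (j + 1 : ℕ) * dNorm Z Q (gridFunction d t)) := by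
    field_simp
  rw [e, abs_mul, Nat.abs_cast, mul_comm (max K 0), mul_assoc]
  refine mul_le_mul_of_nonneg_left (h.trans ?_) hj0.le
  have hc0 := hc.1.le
  have hp : (c / (j + 1 : ℕ)) ^ (1 + δ) ≤ c ^ (1 + δ) :=
    Real.rpow_le_rpow (by positivity) hcj (by linarith)
  exact mul_le_mul (le_max_left _ _) hp (by positivity) (le_max_right _ _)

/-! ### The test statistic and its limit -/

lemma sum_Icc_one_eq_sum_range (k : ℕ) (f : ℕ → ℝ) :
    ∑ j ∈ Finset.Icc 1 k, f j = ∑ j ∈ Finset.range k, f (j + 1) := by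
  rw [Finset.range_eq_Ico, Finset.sum_Ico_add' f 0 k 1]
  rfl

lemma testStatistic_eq {n : ℕ} (k d : ℕ) (t : ℕ → I) (v : Fin n → I → ℝ) (c : ℝ) :
    testStatistic k d (fun i r => v i (t r)) c =
      (∑ j ∈ Finset.range k, ((j + 1 : ℕ) * ∑ m, exceedanceIndicator d t c (v m) j -
        1 / (k : ℝ) * ∑ l ∈ Finset.range k,
          (l + 1 : ℕ) * ∑ m, exceedanceIndicator d t c (v m) l) ^ 2) /
        (1 / (k : ℝ) * ∑ l ∈ Finset.range k,
          (l + 1 : ℕ) * ∑ m, exceedanceIndicator d t c (v m) l) := by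
  simp only [testStatistic, meanCount, sum_Icc_one_eq_sum_range]
  rfl

/-- Splits the bias `n c ^ (1 + δ)` into a factor that vanishes by assumption and one of order at
most `√(a n)`. -/
lemma mul_rpow_eq_sqrt_mul_sqrt (n : ℕ) {c δ : ℝ} (hc : 0 < c) :
    (n : ℝ) * c ^ (1 + δ) = √(n * c ^ (1 + 2 * δ)) * √(n * c) := by
  rw [← Real.sqrt_mul (by positivity)]
  refine (Real.sqrt_mul_self (by positivity)).symm.trans (congrArg Real.sqrt ?_)
  have h : c ^ (1 + δ) * c ^ (1 + δ) = c ^ (1 + 2 * δ) * c := by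
    conv_rhs => rw [← Real.rpow_one c, ← Real.rpow_mul hc.le, one_mul, ← Real.rpow_add hc]
    rw [← Real.rpow_add hc]
    congr 1; ring
  linear_combination (n : ℝ) ^ 2 * h

theorem mainTheorem6
    {Ω₀ Ω₁ Ω₂ : Type*} {Ω : ℕ → Type*}
    [MeasurableSpace Ω₀] [MeasurableSpace Ω₁] [MeasurableSpace Ω₂] [∀ n, MeasurableSpace (Ω n)]
    (P₀ : Measure Ω₀) [IsProbabilityMeasure P₀]
    (P₁ : Measure Ω₁) [IsProbabilityMeasure P₁]
    (P₂ : Measure Ω₂) [IsProbabilityMeasure P₂]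
    (P : ∀ n, Measure (Ω n)) [∀ n, IsProbabilityMeasure (P n)]
    -- the copula process, and the generator process of the D-norm
    (U : I → Ω₀ → ℝ) (hU : IsCopulaProcess U P₀)
    (Z : I → Ω₁ → ℝ) (hZ : IsGeneratorProcess Z P₁)
    (δ : ℝ) (hδ : 0 < δ) (hUZ : UniformDeltaNeighborhood U P₀ Z P₁ δ)
    -- the grids
    (d : ℕ → ℕ) (t : ℕ → ℕ → I) (hgrid : ∀ n, IsGrid (d n) (t n))
    (hd : Tendsto d atTop atTop)
    (hmesh : Tendsto (fun n => gridMesh (d n) (t n)) atTop (𝓝 0))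
    -- for each n, the sample of n independent copies of U
    (V : ∀ n, Fin n → I → Ω n → ℝ)
    (hVind : ∀ n, iIndepFun (fun i ω s => V n i s ω) (P n))
    (hVid : ∀ n i, IdentDistrib (fun ω s => V n i s ω) (fun ω s => U s ω) (P n) P₀)
    -- the thresholds
    (c : ℕ → ℝ) (hc : Tendsto c atTop (𝓝 0))
    (hnc : Tendsto (fun n : ℕ => (n : ℝ) * c n) atTop atTop)
    (hncδ : Tendsto (fun n : ℕ => (n : ℝ) * c n ^ (1 + 2 * δ)) atTop (𝓝 0))
    -- the independent standard normal random variables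
    (k : ℕ) (hk : 1 ≤ k)
    (ξ : Fin (k - 1) → Ω₂ → ℝ) (hξind : iIndepFun ξ P₂)
    (hξ : ∀ i, HasLaw (ξ i) (gaussianReal 0 1) P₂) :
    TendstoInDistribution
      (fun n ω => testStatistic k (d n) (fun i r => V n i (t n r) ω) (c n))
      atTop
      (fun ω => ∑ i : Fin (k - 1), limitWeight k (i + 1) * ξ i ω ^ 2)
      P P₂ := by
  obtain ⟨K, hK0, hK⟩ := hUZ.exists_abs_integral_exceedanceIndicator_sub_le hU hδ
  have hUm : AEMeasurable (fun ω s => U s ω) P₀ :=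
    (measurable_pi_lambda _ hU.measurable).aemeasurable
  -- eventual positivity of the thresholds
  have hcpos : ∀ᶠ n in atTop, 0 < c n := by
    filter_upwards [hnc.eventually_gt_atTop 0] with n hn
    exact pos_of_mul_pos_right hn (Nat.cast_nonneg n)
  have hcright : Tendsto c atTop (𝓝[>] 0) := tendsto_nhdsWithin_iff.mpr ⟨hc, hcpos⟩
  have hKn := hcright.eventually hK
  -- the D-norms of the grid functions are bounded away from zero
  set m : ℕ → ℝ := fun n => dNorm Z P₁ (gridFunction (d n) (t n)) with hm
  have hcδ : Tendsto (fun n => K * c n ^ δ) atTop (𝓝 0) := by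
    have := (hc.rpow_const (p := δ) (Or.inr hδ.le)).const_mul K
    rwa [Real.zero_rpow hδ.ne', mul_zero] at this
  have hmhalf : ∀ᶠ n in atTop, 1 / 2 ≤ m n := by
    filter_upwards [hcpos, hKn, hc.eventually_le_const one_pos,
      hcδ.eventually_le_const (show (0 : ℝ) < 1 / 2 by norm_num)] with n h0 hn h1 h2
    -- One grid point alone gives exceedance probability `c`, so `c ≤ c m + K c ^ (1 + δ)`, that is
    -- `m ≥ 1 - K c ^ δ`.
    have hlow := le_integral_exceedanceIndicator hU (t := t n)
      (one_le_two.trans (hgrid n).1) h0.le h1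
    have hup := (abs_le.mp (hn (d n) (t n) 0)).2
    simp only [zero_add, Nat.cast_one, one_mul, mul_one] at hup
    rw [Real.rpow_add h0, Real.rpow_one] at hup
    have : c n * (1 - K * c n ^ δ) ≤ c n * m n := by simp only [hm]; linarith
    have := le_of_mul_le_mul_left this h0
    linarith
  -- the normalisation of the counts
  set a : ℕ → ℝ := fun n => if 0 < n * c n * m n then n * c n * m n else 1 with ha
  have haev : ∀ᶠ n in atTop, a n = n * c n * m n ∧ n * c n / 2 ≤ a n ∧ 0 < n * c n := by
    filter_upwards [hnc.eventually_gt_atTop 0, hmhalf] with n h0 h1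
    have hpos : 0 < n * c n * m n := mul_pos h0 (by linarith)
    have e : a n = n * c n * m n := if_pos hpos
    refine ⟨e, ?_, h0⟩
    rw [e, div_eq_mul_one_div]
    exact mul_le_mul_of_nonneg_left h1 h0.le
  have harray : IsNestedIndicatorArray P₀ P k
      (fun n i ω => exceedanceIndicator (d n) (t n) (c n) fun s => V n i s ω)
      (fun n ω => exceedanceIndicator (d n) (t n) (c n) fun s => U s ω) a := by
    refine ⟨fun n => (hVind n).comp _ fun _ => measurable_exceedanceIndicator _ _ _,
      fun n i => (hVid n i).comp (measurable_exceedanceIndicator _ _ _),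
      fun n => (measurable_exceedanceIndicator _ _ _).comp_aemeasurable hUm,
      fun n ω j => exceedanceIndicator_zero_or_one _ _ _ _ _, ?_, ?_, ?_, ?_⟩
    -- Nesting is required only eventually because `c n` may be negative for small `n`.
    · filter_upwards [hcpos] with n hn ω j l hjl
      exact exceedanceIndicator_mul hn.le hjl
    -- Positivity is required for every `n`; the default value `1` in `a` serves the finitely many
    -- `n` where `n c m` is not positive.
    · intro n
      simp only [ha]
      split_ifs with h
      · exact h
      · exact one_pos
    · refine tendsto_atTop_mono' _ ?_ (hnc.atTop_div_const two_pos)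
      filter_upwards [haev] with n hn using hn.2.1
    · intro j _
      have hlim : Tendsto (fun n : ℕ => K * (j + 1 : ℕ) * √2 * √((n : ℝ) * c n ^ (1 + 2 * δ)))
          atTop (𝓝 0) := by
        have := (hncδ.sqrt).const_mul (K * (j + 1 : ℕ) * √2)
        rwa [Real.sqrt_zero, mul_zero] at this
      refine squeeze_zero_norm' ?_ hlim
      filter_upwards [hKn, haev, hcpos] with n hn han h0
      obtain ⟨hae, hale, hpos⟩ := han
      have hapos : 0 < a n := lt_of_lt_of_le (by positivity) hale
      have hb := mul_le_mul_of_nonneg_left (hn (d n) (t n) j) (Nat.cast_nonneg (α := ℝ) n)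
      have hsq : √(n * c n) ≤ √2 * √(a n) := by
        rw [← Real.sqrt_mul two_pos.le]
        exact Real.sqrt_le_sqrt (by linarith)
      rw [Real.norm_eq_abs, abs_div, abs_of_nonneg (Real.sqrt_nonneg _),
        div_le_iff₀ (Real.sqrt_pos.mpr hapos), hae, mul_assoc (n : ℝ), ← mul_sub, abs_mul,
        Nat.abs_cast, ← mul_assoc (n : ℝ), ← hae]
      refine hb.trans ?_
      calc (n : ℝ) * (K * (j + 1 : ℕ) * c n ^ (1 + δ))
          = K * (j + 1 : ℕ) * ((n : ℝ) * c n ^ (1 + δ)) := by ring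
        _ = K * (j + 1 : ℕ) * √(n * c n ^ (1 + 2 * δ)) * √(n * c n) := by
          rw [mul_rpow_eq_sqrt_mul_sqrt n h0]; ring
        _ ≤ K * (j + 1 : ℕ) * √(n * c n ^ (1 + 2 * δ)) * (√2 * √(a n)) :=
          mul_le_mul_of_nonneg_left hsq (by positivity)
        _ = _ := by ring
  refine (harray.tendstoInDistribution_dispersion hk hξind hξ).congr
    (fun n => ae_of_all _ fun ω => ?_) (ae_of_all _ fun ω => rfl)
  exact (testStatistic_eq k (d n) (t n) (fun i s => V n i s ω) (c n)).symm
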